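/- Let $G$ be a compact (Hausdorff) topological group with normalized Haar measure $dx$, $\int_G dx=1$, and let $\lambda$ be the left regular representation of $G$ on $L^2(G)$, $(\lambda(g)f)(y)=f(g^{-1}y)$. Let $\widehat G$ be the set of equivalence classes of irreducible (finite-dimensional, continuous, unitary, complex) representations of $G$; for $\alpha\in\widehat G$ let $n^\alpha$ be its dimension and $\chi^\alpha$ its character. Let $L^2(G)^\alpha\subset L^2(G)$ be the isotypic component of type $\alpha$ of $\lambda$, i.e. the closed linear span of the images of all $G$-intertwining maps into $(\lambda,L^2(G))$ from a representation of class $\alpha$, and let $P^\alpha$ be the orthogonal projection of $L^2(G)$ onto $L^2(G)^\alpha$. Let $C_0\subset G$ be a conjugacy class, let $\chi^\alpha(C_0)$ be the common value of $\chi^\alpha$ on the elements of $C_0$, and let $$\lambda(C_0)=\int_G \lambda(xg_0x^{-1})\,dx ,\qquad g_0\in C_0,$$ be the class operator on $L^2(G)$, where the integral is taken in the strong sense, $\lambda(C_0)f=\int_G\lambda(xg_0x^{-1})f\,dx$ for $f\in L^2(G)$; it does not depend on the choice of $g_0\in C_0$. Then $$\lambda(C_0)=\sum_{\alpha\in\widehat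 G}\frac{1}{n^\alpha}\,\chi^\alpha(C_0)\,P^\alpha ,$$ the sum converging unconditionally in the strong operator topology. Moreover, for every $\alpha\in\widehat G$ and every $g_0\in C_0$, $\lambda(C_0)$ acts on $L^2(G)^\alpha$ as the scalar $\chi^\alpha(g_0)/n^\alpha$. -/

import Mathlib

open MeasureTheory

noncomputable section

namespace ClassOp

universe u

section Dual

variable (G : Type u) [Group G] [TopologicalSpace G]

/-- A finite-dimensional, continuous, unitary, irreducible complex representation of `G`,
realised on a standard Hilbert space `ℂⁿ`. -/
structure UnitaryIrrep where
  /-- The dimension `n` of the representation. -/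
  dim : ℕ
  /-- The action of `G` by linear maps. -/
  rep : Representation ℂ G (EuclideanSpace ℂ (Fin dim))
  /-- The action is strongly continuous. -/
  continuous_rep : ∀ v, Continuous fun g => rep g v
  /-- The action is isometric, that is unitary. -/
  norm_rep : ∀ g v, ‖rep g v‖ = ‖v‖
  /-- The space is non-zero and has no invariant subspace besides `0` and itself. -/
  irreducible : rep.IsIrreducible

/-- Equivalence of representations: existence of a bijective intertwining map. -/
instance UnitaryIrrep.setoid : Setoid (UnitaryIrrep G) where
  r ρ σ := Nonempty (ρ.rep.Equiv σ.rep)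
  iseqv :=
    { refl := fun ρ => ⟨Representation.Equiv.refl ρ.rep⟩
      symm := fun ⟨e⟩ => ⟨e.symm⟩
      trans := fun ⟨e⟩ ⟨f⟩ => ⟨e.trans f⟩ }

/-- The dual `Ĝ`: the set of equivalence classes of irreducible representations of `G`. -/
def Dual : Type u := Quotient (UnitaryIrrep.setoid G)

variable {G}

/-- The dimension `n^α` of the class `α`. -/
def Dual.dim (α : Dual G) : ℕ :=
  Quotient.lift (fun ρ : UnitaryIrrep G => ρ.dim)
    (by
      rintro ρ σ ⟨e⟩
      simpa using e.toLinearEquiv.finrank_eq) α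

/-- The character `χ^α` of the class `α`, a function on `G`. -/
def Dual.character (α : Dual G) : G → ℂ :=
  Quotient.lift (fun ρ : UnitaryIrrep G => ρ.rep.character)
    (by
      rintro ρ σ ⟨e⟩
      exact Representation.char_iso e) α

theorem Dual.character_eq_of_isConj (α : Dual G) {g h : G} (hgh : IsConj g h) :
    α.character g = α.character h := by
  obtain ⟨c, rfl⟩ := isConj_iff.1 hgh
  induction α using Quotient.inductionOn with
  | h ρ =>
    change ρ.rep.character g = ρ.rep.character (c * g * c⁻¹)
    rw [Representation.char_mul_comm]
    simp

/-- The common value `χ^α(C₀)` of the character `χ^α` on the conjugacy class `C₀`. -/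
def Dual.characterOn (α : Dual G) (C₀ : ConjClasses G) : ℂ :=
  Quotient.lift α.character (fun _ _ h => α.character_eq_of_isConj h) C₀

/-- The isotypic component of type `α` of a representation `π` on a normed space `H`: the
closed linear span of the ranges of all intertwining maps into `π` from an irreducible
representation of class `α`. -/
def Dual.isotypic {H : Type*} [NormedAddCommGroup H] [NormedSpace ℂ H]
    (α : Dual G) (π : Representation ℂ G H) : Submodule ℂ H :=
  Quotient.lift
    (fun ρ : UnitaryIrrep G =>
      (⨆ φ : ρ.rep.IntertwiningMap π, LinearMap.range φ.toLinearMap).topologicalClosure)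
    (by
      have key : ∀ ρ σ : UnitaryIrrep G, ρ.rep.Equiv σ.rep →
          (⨆ φ : ρ.rep.IntertwiningMap π, LinearMap.range φ.toLinearMap) ≤
            ⨆ φ : σ.rep.IntertwiningMap π, LinearMap.range φ.toLinearMap := by
        intro ρ σ e
        refine iSup_le fun φ => ?_
        refine le_trans ?_ (le_iSup _ (φ.comp e.symm.toIntertwiningMap))
        rintro _ ⟨v, rfl⟩
        refine ⟨e v, ?_⟩
        change φ (e.symm (e v)) = φ v
        congr 1
        exact e.toLinearEquiv.symm_apply_apply v
      rintro ρ σ ⟨e⟩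
      rw [le_antisymm (key ρ σ e) (key σ ρ e.symm)]) α

theorem Dual.isClosed_isotypic {H : Type*} [NormedAddCommGroup H] [NormedSpace ℂ H]
    (α : Dual G) (π : Representation ℂ G H) : IsClosed (α.isotypic π : Set H) := by
  induction α using Quotient.inductionOn with
  | h ρ => exact Submodule.isClosed_topologicalClosure _

instance {H : Type*} [NormedAddCommGroup H] [InnerProductSpace ℂ H] [CompleteSpace H]
    (α : Dual G) (π : Representation ℂ G H) : (α.isotypic π).HasOrthogonalProjection :=
  haveI : CompleteSpace (α.isotypic π) := (α.isClosed_isotypic π).completeSpace_coe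
  Submodule.HasOrthogonalProjection.ofCompleteSpace _

/-- The orthogonal projection `P^α` of `H` onto the isotypic component of type `α`. -/
def Dual.proj {H : Type*} [NormedAddCommGroup H] [InnerProductSpace ℂ H] [CompleteSpace H]
    (α : Dual G) (π : Representation ℂ G H) : H →L[ℂ] H :=
  (α.isotypic π).starProjection

end Dual

section Regular

variable {G : Type u} [Group G] [TopologicalSpace G] [IsTopologicalGroup G]
  [MeasurableSpace G] [BorelSpace G]

/-- The left regular representation of `G` on `L²(G)`: `(λ(g) f)(x) = f(g⁻¹ x)`. -/
def leftRegular (μ : Measure G) [μ.IsMulLeftInvariant] :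
    Representation ℂ G (Lp ℂ 2 μ) where
  toFun g := Lp.compMeasurePreservingₗ ℂ (fun x => g⁻¹ * x) (measurePreserving_mul_left μ g⁻¹)
  map_one' := by
    ext1 f
    apply Lp.ext
    refine (Lp.coeFn_compMeasurePreserving f (measurePreserving_mul_left μ (1 : G)⁻¹)).trans ?_
    simp [Function.comp_def]
  map_mul' g h := by
    ext1 f
    have e : DomMulAct.mk (g * h)⁻¹ = DomMulAct.mk g⁻¹ * DomMulAct.mk h⁻¹ := by
      rw [mul_inv_rev]; rfl
    change DomMulAct.mk (g * h)⁻¹ • f = DomMulAct.mk g⁻¹ • DomMulAct.mk h⁻¹ • f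
    rw [e, mul_smul]

theorem leftRegular_ae_eq (μ : Measure G) [μ.IsMulLeftInvariant] (g : G) (f : Lp ℂ 2 μ) :
    leftRegular μ g f =ᵐ[μ] fun x => f (g⁻¹ * x) :=
  Lp.coeFn_compMeasurePreserving f (measurePreserving_mul_left μ g⁻¹)

theorem norm_leftRegular (μ : Measure G) [μ.IsMulLeftInvariant] (g : G) (f : Lp ℂ 2 μ) :
    ‖leftRegular μ g f‖ = ‖f‖ :=
  Lp.norm_compMeasurePreserving f (measurePreserving_mul_left μ g⁻¹)

variable [CompactSpace G] (μ : Measure G) [μ.IsHaarMeasure]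

/-- The left regular representation is strongly continuous. -/
theorem continuous_leftRegular (f : Lp ℂ 2 μ) : Continuous fun g => leftRegular μ g f := by
  have : Fact ((2 : ENNReal) ≠ ⊤) := ⟨by simp⟩
  have h : Continuous fun g : G => DomMulAct.mk g⁻¹ • f :=
    (DomMulAct.continuous_mk.comp continuous_inv).smul continuous_const
  exact h

theorem integrable_leftRegular_conj (g₀ : G) (f : Lp ℂ 2 μ) :
    Integrable (fun x => leftRegular μ (x * g₀ * x⁻¹) f) μ := by
  have h : Continuous fun x : G => leftRegular μ (x * g₀ * x⁻¹) f :=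
    (continuous_leftRegular μ f).comp (by fun_prop)
  exact h.integrable_of_hasCompactSupport (HasCompactSupport.of_compactSpace _)

/-- The operator `∫_G λ(x g₀ x⁻¹) dx` on `L²(G)`; the integral is taken in the strong sense,
that is as an `L²(G)`-valued Bochner integral after application to a vector `f`. -/
def classOperatorAt (g₀ : G) : Lp ℂ 2 μ →L[ℂ] Lp ℂ 2 μ :=
  LinearMap.mkContinuous
    { toFun := fun f => ∫ x, leftRegular μ (x * g₀ * x⁻¹) f ∂μ
      map_add' := fun f h => by
        simp only [map_add]
        exact integral_add (integrable_leftRegular_conj μ g₀ f)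
          (integrable_leftRegular_conj μ g₀ h)
      map_smul' := fun c f => by
        simp only [map_smul, RingHom.id_apply]
        exact integral_smul c _ }
    (μ.real Set.univ)
    (fun f => by
      refine (norm_integral_le_integral_norm _).trans ?_
      simp [norm_leftRegular])

theorem classOperatorAt_apply (g₀ : G) (f : Lp ℂ 2 μ) :
    classOperatorAt μ g₀ f = ∫ x, leftRegular μ (x * g₀ * x⁻¹) f ∂μ := rfl

theorem map_mul_right_eq [IsProbabilityMeasure μ] (c : G) : μ.map (fun x => x * c) = μ := by
  have : IsProbabilityMeasure (μ.map fun x => x * c) :=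
    Measure.isProbabilityMeasure_map (by fun_prop)
  exact Measure.isHaarMeasure_eq_of_isProbabilityMeasure _ _

theorem classOperatorAt_eq_of_isConj [IsProbabilityMeasure μ] {g h : G} (hgh : IsConj g h) :
    classOperatorAt μ g = classOperatorAt μ h := by
  obtain ⟨c, rfl⟩ := isConj_iff.1 hgh
  ext1 f
  rw [classOperatorAt_apply, classOperatorAt_apply]
  have h := (Homeomorph.mulRight c).isClosedEmbedding.measurableEmbedding.integral_map
    (μ := μ) (fun x => leftRegular μ (x * g * x⁻¹) f)
  rw [Homeomorph.coe_mulRight, map_mul_right_eq μ c] at h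
  rw [h]
  simp [mul_assoc]

/-- The class operator `λ(C₀) = ∫_G λ(x g₀ x⁻¹) dx` based on the conjugacy class `C₀` of `g₀`;
it does not depend on the choice of `g₀` in `C₀`. -/
def classOperator [IsProbabilityMeasure μ] (C₀ : ConjClasses G) : Lp ℂ 2 μ →L[ℂ] Lp ℂ 2 μ :=
  Quotient.lift (classOperatorAt μ) (fun _ _ h => classOperatorAt_eq_of_isConj μ h) C₀

end Regular

end ClassOp

end

/-! Two facts combine. First, if `φ` intertwines an irreducible `ρ` with the regular representation,
the class operator passes through `φ` and becomes the average of `ρ` over the class. That average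
commutes with `ρ`, so by Schur it is a scalar, and its trace identifies the scalar as `χ/n`;
continuity extends this to the closed span. Second, any strongly continuous unitary representation
of a compact group is the Hilbert sum of its isotypic components. Schur gives orthogonality. For
completeness, averaging a rank one operator over an orbit yields a non-zero compact self-adjoint
operator commuting with `G`, whose eigenspaces supply finite-dimensional invariant subspaces in any
non-zero orthogonal complement. Applying the bounded class operator to `f = ∑ P^α f` gives the
formula. -/

noncomputable section

namespace ClassOp

open InnerProductSpace

/-! ### Invariance of inner products and orthogonal complements -/

section UnitaryRepresentation

variable {G : Type*} [Group G] {H : Type*} [NormedAddCommGroup H] [InnerProductSpace ℂ H]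
  {π : Representation ℂ G H}

theorem inner_map_map_of_norm (hn : ∀ g v, ‖π g v‖ = ‖v‖) (g : G) (v w : H) :
    inner ℂ (π g v) (π g w) = inner ℂ v w :=
  (⟨π g, hn g⟩ : H →ₗᵢ[ℂ] H).inner_map_map v w

theorem inner_map_left_of_norm (hn : ∀ g v, ‖π g v‖ = ‖v‖) (g : G) (v w : H) :
    inner ℂ (π g v) w = inner ℂ v (π g⁻¹ w) := by
  rw [← inner_map_map_of_norm hn g v, ← Module.End.mul_apply, ← map_mul, mul_inv_cancel, map_one,
    Module.End.one_apply]

theorem map_mem_orthogonal_of_norm (hn : ∀ g v, ‖π g v‖ = ‖v‖) {K : Submodule ℂ H}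
    (hK : ∀ g, ∀ v ∈ K, π g v ∈ K) (g : G) {w : H} (hw : w ∈ Kᗮ) : π g w ∈ Kᗮ := by
  intro v hv
  have := hw _ (hK g⁻¹ v hv)
  rwa [inner_map_left_of_norm hn, inv_inv] at this

end UnitaryRepresentation

/-! ### Compact commuting operators and finite-dimensional invariant subspaces -/

section AveragedRankOne

theorem integrable_of_continuous {X E : Type*} [TopologicalSpace X] [CompactSpace X]
    [MeasurableSpace X] [BorelSpace X] (μ : Measure X) [IsFiniteMeasureOnCompacts μ]
    [NormedAddCommGroup E] {f : X → E} (hf : Continuous f) : Integrable f μ :=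
  hf.integrable_of_hasCompactSupport (HasCompactSupport.of_compactSpace _)

variable {G : Type*} [Group G] [TopologicalSpace G] [CompactSpace G]
  [MeasurableSpace G] [BorelSpace G] (μ : Measure G) [μ.IsHaarMeasure]
  {H : Type*} [NormedAddCommGroup H] [InnerProductSpace ℂ H] [CompleteSpace H]
  {π : Representation ℂ G H}

/-- The average over `G` of the rank one operators `⟨π(x) v, ·⟩ π(x) v`. -/
def averagedRankOne (π : Representation ℂ G H) (v : H) : H →L[ℂ] H :=
  ∫ x, rankOne ℂ (π x v) (π x v) ∂μ

omit [CompactSpace G] [MeasurableSpace G] [BorelSpace G]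
  [CompleteSpace H] in
theorem continuous_rankOne_orbit (hc : ∀ v, Continuous fun g => π g v) (v : H) :
    Continuous fun x => rankOne ℂ (π x v) (π x v) :=
  by
  simp_rw [rankOne_def']
  exact (ContinuousLinearMap.toSpanSingletonCLE.continuous.comp (hc v)).clm_comp
    ((innerSL ℂ).continuous.comp (hc v))

omit [CompleteSpace H] in
theorem averagedRankOne_apply (hc : ∀ v, Continuous fun g => π g v) (v w : H) :
    averagedRankOne μ π v w = ∫ x, inner ℂ (π x v) w • π x v ∂μ := by
  rw [averagedRankOne, ContinuousLinearMap.integral_apply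
    (integrable_of_continuous μ (continuous_rankOne_orbit hc v))]
  simp

omit [CompleteSpace H] in
theorem integrable_inner_smul_orbit (hc : ∀ v, Continuous fun g => π g v) (v w : H) :
    Integrable (fun x => inner ℂ (π x v) w • π x v) μ :=
  integrable_of_continuous μ (((hc v).inner continuous_const).smul (hc v))

theorem inner_averagedRankOne (hc : ∀ v, Continuous fun g => π g v) (v w u : H) :
    inner ℂ u (averagedRankOne μ π v w) = ∫ x, inner ℂ (π x v) w * inner ℂ u (π x v) ∂μ := by
  rw [averagedRankOne_apply μ hc, ← integral_inner (integrable_inner_smul_orbit μ hc v w)]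
  simp [inner_smul_right]

theorem isSymmetric_averagedRankOne (hc : ∀ v, Continuous fun g => π g v) (v : H) :
    (averagedRankOne μ π v).IsSymmetric := by
  intro w u
  change inner ℂ (averagedRankOne μ π v w) u = inner ℂ w (averagedRankOne μ π v u)
  rw [← inner_conj_symm, inner_averagedRankOne μ hc, inner_averagedRankOne μ hc, ← integral_conj]
  simp [mul_comm]

theorem averagedRankOne_map [IsTopologicalGroup G] (hn : ∀ g v, ‖π g v‖ = ‖v‖)
    (hc : ∀ v, Continuous fun g => π g v)
    (v w : H) (g : G) :
    averagedRankOne μ π v (π g w) = π g (averagedRankOne μ π v w) := by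
  let U : H →ₗᵢ[ℂ] H := ⟨π g, hn g⟩
  change _ = U.toContinuousLinearMap (averagedRankOne μ π v w)
  rw [averagedRankOne_apply μ hc, averagedRankOne_apply μ hc,
    ← ContinuousLinearMap.integral_comp_comm _ (integrable_inner_smul_orbit μ hc v w),
    -- Left invariance replaces `x` by `g * x`, after which unitarity cancels `g` inside the inner
    -- product.
    ← integral_mul_left_eq_self _ g]
  congr 1 with x
  change _ = π g (inner ℂ (π x v) w • π x v)
  rw [map_smul, map_mul, Module.End.mul_apply, inner_map_map_of_norm hn]

theorem averagedRankOne_mem_orthogonal (hn : ∀ g v, ‖π g v‖ = ‖v‖)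
    (hc : ∀ v, Continuous fun g => π g v) {K : Submodule ℂ H}
    (hK : ∀ g, ∀ v ∈ K, π g v ∈ K) {v : H} (hv : v ∈ Kᗮ) (w : H) :
    averagedRankOne μ π v w ∈ Kᗮ := by
  intro k hk
  rw [inner_averagedRankOne μ hc]
  have (x : G) : inner ℂ k (π x v) = 0 := map_mem_orthogonal_of_norm hn hK x hv k hk
  simp [this]

/-- Its quadratic form at `v` is `∫ |⟨v, π(x) v⟩|² dx`, with a continuous non-negative integrand
that is positive at `x = 1`; Haar measure charges open sets. -/
theorem averagedRankOne_ne_zero (hc : ∀ v, Continuous fun g => π g v) {v : H} (hv : v ≠ 0) :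
    averagedRankOne μ π v ≠ 0 := by
  intro h
  have h1 : inner ℂ v (averagedRankOne μ π v v) = 0 := by simp [h]
  rw [inner_averagedRankOne μ hc] at h1
  have h2 (x : G) : inner ℂ (π x v) v * inner ℂ v (π x v) =
      ((‖inner ℂ v (π x v)‖ ^ 2 : ℝ) : ℂ) := by
    rw [← inner_conj_symm, mul_comm, Complex.mul_conj, Complex.normSq_eq_norm_sq]
  simp_rw [h2] at h1
  rw [integral_complex_ofReal] at h1
  have hcont : Continuous fun x => ‖inner ℂ v (π x v)‖ ^ 2 :=
    ((continuous_const.inner (hc v)).norm).pow 2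
  refine (hcont.integral_pos_of_hasCompactSupport_nonneg_nonzero (μ := μ) (x := 1)
    (HasCompactSupport.of_compactSpace _) (fun x => by positivity) ?_).ne' (by exact_mod_cast h1)
  simp [hv]

/-- Compact operators form a norm-closed convex set, which therefore contains averages of rank one
operators against a probability measure. -/
theorem isCompactOperator_averagedRankOne [IsProbabilityMeasure μ]
    (hc : ∀ v, Continuous fun g => π g v) (v : H) :
    IsCompactOperator (averagedRankOne μ π v) := by
  have hconv : Convex ℝ {f : H →L[ℂ] H | IsCompactOperator f} := by
    intro f hf g hg a b _ _ _
    exact (hf.smul a).add (hg.smul b)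
  refine hconv.integral_mem isClosed_setOfPred_isCompactOperator (.of_forall fun x => ?_)
    (integrable_of_continuous μ (continuous_rankOne_orbit hc v))
  change IsCompactOperator (rankOne ℂ (π x v) (π x v))
  rw [rankOne_def']
  have h : IsCompactOperator (ContinuousLinearMap.toSpanSingleton ℂ (π x v)) :=
    isCompactOperator_of_locallyCompactSpace_rng _
  exact h.comp_clm (innerSL ℂ (π x v))

/-- The complement of an invariant subspace under a strongly continuous unitary representation of
a compact group is either zero or contains a non-zero finite-dimensional invariant subspace. -/
theorem exists_finiteDimensional_invariant_le_orthogonal [IsTopologicalGroup G]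
    [IsProbabilityMeasure μ]
    (hn : ∀ g v, ‖π g v‖ = ‖v‖)
    (hc : ∀ v, Continuous fun g => π g v) {K : Submodule ℂ H}
    (hK : ∀ g, ∀ v ∈ K, π g v ∈ K) (hne : Kᗮ ≠ ⊥) :
    ∃ W : Submodule ℂ H, W ≠ ⊥ ∧ FiniteDimensional ℂ W ∧ W ≤ Kᗮ ∧ ∀ g, ∀ v ∈ W, π g v ∈ W := by
  obtain ⟨v, hv, hv0⟩ := Submodule.exists_mem_ne_zero_of_ne_bot hne
  have hcomp := isCompactOperator_averagedRankOne μ hc v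
  -- Spectral theorem: a non-zero compact self-adjoint operator has an eigenvalue `c ≠ 0`. Its
  -- eigenspace is the required `W`.
  have hT := (ContinuousLinearMap.eq_zero_of_forall_hasEigenvalue_eq_zero hcomp
    (isSymmetric_averagedRankOne μ hc v)).not.2 (averagedRankOne_ne_zero μ hc hv0)
  push Not at hT
  obtain ⟨c, hc1, hc0⟩ := hT
  refine ⟨_, hc1, ContinuousLinearMap.finite_dimensional_eigenspace hcomp c hc0, ?_, ?_⟩
  · intro w hw
    have hw' : averagedRankOne μ π v w = c • w := Module.End.mem_eigenspace_iff.1 hw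
    have : w = c⁻¹ • averagedRankOne μ π v w := by rw [hw', inv_smul_smul₀ hc0]
    rw [this]
    exact Submodule.smul_mem _ _ (averagedRankOne_mem_orthogonal μ hn hc hK hv w)
  · intro g w hw
    have hw' : averagedRankOne μ π v w = c • w := Module.End.mem_eigenspace_iff.1 hw
    refine Module.End.mem_eigenspace_iff.2 ?_
    change averagedRankOne μ π v (π g w) = c • π g w
    rw [averagedRankOne_map μ hn hc, hw', map_smul]

end AveragedRankOne

/-! ### Irreducible subrepresentations -/

section Subrepresentation

variable {G : Type*} [Group G] [TopologicalSpace G]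
  {H : Type*} [NormedAddCommGroup H] [InnerProductSpace ℂ H] {π : Representation ℂ G H}

/-- A minimal finite-dimensional invariant subspace of a unitary representation, realised on a
standard Hilbert space. -/
theorem exists_unitaryIrrep_of_minimal (hn : ∀ g v, ‖π g v‖ = ‖v‖)
    (hc : ∀ v, Continuous fun g => π g v) {W : Submodule ℂ H} [FiniteDimensional ℂ W]
    (hW : W ≠ ⊥) (hinv : ∀ g, ∀ v ∈ W, π g v ∈ W)
    (hmin : ∀ W' ≤ W, (∀ g, ∀ v ∈ W', π g v ∈ W') → W' = ⊥ ∨ W' = W) :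
    ∃ (ρ : UnitaryIrrep G) (φ : ρ.rep.IntertwiningMap π), LinearMap.range φ.toLinearMap = W := by
  let e : W ≃ₗᵢ[ℂ] EuclideanSpace ℂ (Fin (Module.finrank ℂ W)) := (stdOrthonormalBasis ℂ W).repr
  let τ : Representation ℂ G W := (Subrepresentation.mk W hinv).toRepresentation
  have hτ (g : G) (w : W) : (τ g w : H) = π g w := rfl
  let r : Representation ℂ G (EuclideanSpace ℂ (Fin (Module.finrank ℂ W))) :=
    { toFun := fun g => e.toLinearEquiv.conj (τ g)
      map_one' := by simp [Module.End.one_eq_id]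
      map_mul' := fun g h => by rw [map_mul]; exact LinearEquiv.conj_comp _ _ _ }
  have hr (g : G) (v) : r g v = e (τ g (e.symm v)) := rfl
  let ι : EuclideanSpace ℂ (Fin (Module.finrank ℂ W)) →ₗ[ℂ] H :=
    W.subtype ∘ₗ e.symm.toLinearEquiv.toLinearMap
  have hιapp (v) : ι v = (e.symm v : H) := rfl
  have hι (g : G) (v) : ι (r g v) = π g (ι v) := by
    rw [hιapp, hr, e.symm_apply_apply, hτ, hιapp]
  have hιinj : Function.Injective ι := Subtype.val_injective.comp e.symm.injective
  have hιrange : LinearMap.range ι = W := by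
    ext w
    refine ⟨?_, fun hw => ⟨e ⟨w, hw⟩, by simp [hιapp]⟩⟩
    rintro ⟨v, rfl⟩
    exact (e.symm v).2
  -- The injection `ι` carries subrepresentations of `r` to invariant subspaces of `W`, where
  -- minimality applies.
  have hirr : r.IsIrreducible := by
    have hbot (S : Subrepresentation r) (h : S.toSubmodule.map ι = ⊥) : S = ⊥ :=
      Subrepresentation.toSubmodule_injective
        (Submodule.map_injective_of_injective hιinj (h.trans (Submodule.map_bot ι).symm))
    have htop (S : Subrepresentation r) (h : S.toSubmodule.map ι = W) : S = ⊤ := by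
      refine Subrepresentation.toSubmodule_injective (Submodule.map_injective_of_injective hιinj ?_)
      exact h.trans (hιrange.symm.trans (Submodule.map_top ι).symm)
    refine { exists_pair_ne := ⟨⊥, ⊤, fun h => hW ?_⟩, eq_bot_or_eq_top := fun S => ?_ }
    · rw [← hιrange, ← Submodule.map_top]
      change (⊤ : Subrepresentation r).toSubmodule.map ι = ⊥
      rw [← h]
      exact Submodule.map_bot ι
    · refine (hmin (S.toSubmodule.map ι) ?_ ?_).imp (hbot S) (htop S)
      · exact LinearMap.map_le_range.trans hιrange.le
      · rintro g _ ⟨v, hv, rfl⟩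
        exact ⟨r g v, S.apply_mem_toSubmodule g hv, hι g v⟩
  refine ⟨⟨_, r, fun v => ?_, fun g v => ?_, hirr⟩,
    ι.intertwiningMap_of_isIntertwiningMap _ _ hι, hιrange⟩
  · exact e.continuous.comp (continuous_induced_rng.2 (hc (e.symm v)))
  · rw [hr, e.norm_map]
    exact (hn g _).trans (e.symm.norm_map v)

theorem exists_unitaryIrrep_of_finiteDimensional (hn : ∀ g v, ‖π g v‖ = ‖v‖)
    (hc : ∀ v, Continuous fun g => π g v) {W : Submodule ℂ H} [FiniteDimensional ℂ W]
    (hW : W ≠ ⊥) (hinv : ∀ g, ∀ v ∈ W, π g v ∈ W) :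
    ∃ (ρ : UnitaryIrrep G) (φ : ρ.rep.IntertwiningMap π),
      LinearMap.range φ.toLinearMap ≠ ⊥ ∧ LinearMap.range φ.toLinearMap ≤ W := by
  -- A candidate of least dimension is minimal; the bound `V ≤ W` excludes infinite-dimensional
  -- spaces, whose `finrank` is `0`.
  obtain ⟨V, ⟨hV0, hVW, hVinv⟩, hVmin⟩ := WellFounded.has_min
    (measure fun V : Submodule ℂ H => Module.finrank ℂ V).wf
    {V | V ≠ ⊥ ∧ V ≤ W ∧ ∀ g, ∀ v ∈ V, π g v ∈ V} ⟨W, hW, le_rfl, hinv⟩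
  have : FiniteDimensional ℂ V := Submodule.finiteDimensional_of_le hVW
  obtain ⟨ρ, φ, hφ⟩ := exists_unitaryIrrep_of_minimal hn hc hV0 hVinv fun V' hV' hinv' => by
    refine or_iff_not_imp_left.2 fun h0 => Submodule.eq_of_le_of_finrank_le hV' ?_
    exact not_lt.1 (hVmin V' ⟨h0, hV'.trans hVW, hinv'⟩)
  exact ⟨ρ, φ, hφ ▸ hV0, hφ ▸ hVW⟩

end Subrepresentation

/-! ### Hilbert sum of the isotypic components -/

section Isotypic

variable {G : Type*} [Group G] [TopologicalSpace G]
  {H : Type*} [NormedAddCommGroup H] [InnerProductSpace ℂ H] [CompleteSpace H]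
  {π : Representation ℂ G H}

omit [CompleteSpace H] in
theorem range_le_isotypic (ρ : UnitaryIrrep G) (φ : ρ.rep.IntertwiningMap π) :
    LinearMap.range φ.toLinearMap ≤ Dual.isotypic (Quotient.mk _ ρ : Dual G) π :=
  (le_iSup (fun φ : ρ.rep.IntertwiningMap π => LinearMap.range φ.toLinearMap) φ).trans
    (Submodule.le_topologicalClosure _)

omit [CompleteSpace H] in
theorem isotypic_le (ρ : UnitaryIrrep G) {K : Submodule ℂ H} (hK : IsClosed (K : Set H))
    (h : ∀ φ : ρ.rep.IntertwiningMap π, ∀ v, φ v ∈ K) :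
    Dual.isotypic (Quotient.mk _ ρ : Dual G) π ≤ K := by
  refine Submodule.topologicalClosure_minimal _ (iSup_le fun φ => ?_) hK
  rintro _ ⟨v, rfl⟩
  exact h φ v

omit [CompleteSpace H] in
theorem map_mem_isotypic (hn : ∀ g v, ‖π g v‖ = ‖v‖) (α : Dual G) (g : G) {v : H}
    (hv : v ∈ α.isotypic π) : π g v ∈ α.isotypic π := by
  induction α using Quotient.inductionOn with
  | h ρ =>
    have hcont : Continuous (π g) := (⟨π g, hn g⟩ : H →ₗᵢ[ℂ] H).continuous
    refine isotypic_le ρ (K := (Dual.isotypic (Quotient.mk _ ρ : Dual G) π).comap (π g))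
      ((Dual.isClosed_isotypic (Quotient.mk _ ρ : Dual G) π).preimage hcont) (fun φ v => ?_) hv
    rw [Submodule.mem_comap, ← φ.isIntertwining]
    exact range_le_isotypic ρ φ ⟨_, rfl⟩

/-- Intertwining maps from inequivalent irreducible representations have orthogonal ranges. -/
theorem inner_intertwiningMap_eq_zero (hn : ∀ g v, ‖π g v‖ = ‖v‖) {ρ σ : UnitaryIrrep G}
    (hρσ : IsEmpty (ρ.rep.Equiv σ.rep)) (φ : ρ.rep.IntertwiningMap π)
    (ψ : σ.rep.IntertwiningMap π) (v : EuclideanSpace ℂ (Fin ρ.dim))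
    (w : EuclideanSpace ℂ (Fin σ.dim)) : inner ℂ (ψ w) (φ v) = 0 := by
  have := ρ.irreducible
  have := σ.irreducible
  let A := ContinuousLinearMap.adjoint (LinearMap.toContinuousLinearMap ψ.toLinearMap)
  have hA (w u) : inner ℂ w (A u) = inner ℂ (ψ w) u :=
    ContinuousLinearMap.adjoint_inner_right (LinearMap.toContinuousLinearMap ψ.toLinearMap) w u
  -- The composite `ψ* φ` intertwines `ρ` with `σ`, hence vanishes by Schur.
  let η : ρ.rep.IntertwiningMap σ.rep :=
    (A.toLinearMap ∘ₗ φ.toLinearMap).intertwiningMap_of_isIntertwiningMap _ _ fun g v => by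
      refine ext_inner_left ℂ fun w => ?_
      change inner ℂ w (A (φ (ρ.rep g v))) = inner ℂ w (σ.rep g (A (φ v)))
      have h := inner_map_left_of_norm σ.norm_rep g⁻¹ w (A (φ v))
      have h' := inner_map_left_of_norm hn g⁻¹ (ψ w) (φ v)
      rw [inv_inv] at h h'
      rw [← h, hA, hA, φ.isIntertwining, ψ.isIntertwining, h']
  have hη : η = 0 := Subsingleton.elim _ _
  rw [← hA]
  change inner ℂ w (η v) = 0
  simp [hη]

theorem isOrtho_isotypic (hn : ∀ g v, ‖π g v‖ = ‖v‖) {α β : Dual G} (hαβ : α ≠ β) :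
    α.isotypic π ⟂ β.isotypic π := by
  induction α using Quotient.inductionOn with
  | h ρ =>
  induction β using Quotient.inductionOn with
  | h σ =>
    have hρσ : IsEmpty (ρ.rep.Equiv σ.rep) :=
      ⟨fun e => hαβ (Quotient.sound ⟨e⟩)⟩
    -- Orthogonal complements are closed, so each closed span reduces to its generators, one side at
    -- a time.
    refine isotypic_le ρ (Submodule.isClosed_orthogonal _) fun φ v => ?_
    rw [Submodule.mem_orthogonal']
    intro w hw
    refine Submodule.mem_orthogonal_singleton_iff_inner_right.1
      (isotypic_le σ (Submodule.isClosed_orthogonal (ℂ ∙ φ v)) (fun ψ w => ?_) hw)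
    rw [Submodule.mem_orthogonal_singleton_iff_inner_left]
    exact inner_intertwiningMap_eq_zero hn hρσ φ ψ v w

variable [IsTopologicalGroup G] [CompactSpace G] [MeasurableSpace G] [BorelSpace G]

theorem orthogonal_iSup_isotypic_eq_bot (μ : Measure G) [μ.IsHaarMeasure] [IsProbabilityMeasure μ]
    (hn : ∀ g v, ‖π g v‖ = ‖v‖) (hc : ∀ v, Continuous fun g => π g v) :
    (⨆ α : Dual G, α.isotypic π)ᗮ = ⊥ := by
  by_contra hne
  have hinv (g : G) : (⨆ α : Dual G, α.isotypic π) ≤ (⨆ α : Dual G, α.isotypic π).comap (π g) :=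
    iSup_le fun α v hv => le_iSup (fun α : Dual G => α.isotypic π) α (map_mem_isotypic hn α g hv)
  obtain ⟨W, hW, hWfin, hWle, hWinv⟩ :=
    exists_finiteDimensional_invariant_le_orthogonal μ hn hc hinv hne
  obtain ⟨ρ, φ, hφ, hφW⟩ := exists_unitaryIrrep_of_finiteDimensional hn hc hW hWinv
  refine hφ (eq_bot_iff.2 ?_)
  rw [← Submodule.inf_orthogonal_eq_bot (⨆ α : Dual G, α.isotypic π)]
  exact le_inf ((range_le_isotypic ρ φ).trans (le_iSup (fun α : Dual G => α.isotypic π) _))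
    (hφW.trans hWle)

/-- A strongly continuous unitary representation of a compact group is the Hilbert sum of its
isotypic components. -/
theorem hasSum_proj (μ : Measure G) [μ.IsHaarMeasure] [IsProbabilityMeasure μ]
    (hn : ∀ g v, ‖π g v‖ = ‖v‖) (hc : ∀ v, Continuous fun g => π g v) (f : H) :
    HasSum (fun α : Dual G => α.proj π f) f := by
  have (α : Dual G) : CompleteSpace (α.isotypic π) := (α.isClosed_isotypic π).completeSpace_coe
  have hortho : OrthogonalFamily ℂ (fun α : Dual G => α.isotypic π)
      fun α => (α.isotypic π).subtypeₗᵢ := fun α β hαβ v w =>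
    (isOrtho_isotypic hn hαβ).inner_eq v.2 w.2
  have hsum : IsHilbertSum ℂ (fun α : Dual G => α.isotypic π)
      fun α => (α.isotypic π).subtypeₗᵢ := by
    refine IsHilbertSum.mkInternal _ hortho ?_
    rw [(Submodule.topologicalClosure_eq_top_iff).2 (orthogonal_iSup_isotypic_eq_bot μ hn hc)]
  have h := hsum.hasSum_linearIsometryEquiv_symm (hsum.linearIsometryEquiv f)
  rw [LinearIsometryEquiv.symm_apply_apply] at h
  convert h using 2 with α
  -- The abstract `α`-coordinate is the projection: pairing the series with `w` in the `α`-component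
  -- kills every other term.
  refine Submodule.eq_starProjection_of_mem_of_inner_eq_zero (Subtype.mem _) fun w hw => ?_
  have h1 := (innerSL ℂ w).hasSum h
  have h2 : HasSum (fun β : Dual G => innerSL ℂ w ((β.isotypic π).subtypeₗᵢ
      (hsum.linearIsometryEquiv f β))) (innerSL ℂ w ((α.isotypic π).subtypeₗᵢ
      (hsum.linearIsometryEquiv f α))) := by
    refine hasSum_single α fun β hβ => ?_
    exact (isOrtho_isotypic hn hβ.symm).inner_eq hw (Subtype.mem _)
  have h3 := h1.unique h2
  rw [← inner_conj_symm, inner_sub_right]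
  simp only [innerSL_apply_apply] at h3
  rw [h3]
  simp

end Isotypic

/-! ### The scalar by which the class operator acts -/

section ClassAverage

variable {G : Type*} [Group G] [TopologicalSpace G]

theorem UnitaryIrrep.dim_ne_zero (ρ : UnitaryIrrep G) : ρ.dim ≠ 0 := by
  intro h
  have := ρ.irreducible
  have : IsEmpty (Fin ρ.dim) := by rw [h]; infer_instance
  obtain ⟨S, T, hST⟩ := exists_pair_ne (Subrepresentation ρ.rep)
  exact hST (Subrepresentation.toSubmodule_injective (Subsingleton.elim _ _))

variable [IsTopologicalGroup G] [CompactSpace G] [MeasurableSpace G] [BorelSpace G]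
  (μ : Measure G) [μ.IsHaarMeasure]

theorem UnitaryIrrep.integrable_rep_conj (ρ : UnitaryIrrep G) (g₀ : G)
    (v : EuclideanSpace ℂ (Fin ρ.dim)) : Integrable (fun x => ρ.rep (x * g₀ * x⁻¹) v) μ :=
  integrable_of_continuous μ ((ρ.continuous_rep v).comp (by fun_prop))

/-- The average `∫ ρ(x g₀ x⁻¹) dx` of an irreducible representation `ρ` over a conjugacy class,
as an intertwining map of `ρ` with itself. -/
def UnitaryIrrep.classAverage (ρ : UnitaryIrrep G) (g₀ : G) : ρ.rep.IntertwiningMap ρ.rep :=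
  LinearMap.intertwiningMap_of_isIntertwiningMap _ _
    { toFun := fun v => ∫ x, ρ.rep (x * g₀ * x⁻¹) v ∂μ
      map_add' := fun v w => by
        simp only [map_add]
        exact integral_add (ρ.integrable_rep_conj μ g₀ v) (ρ.integrable_rep_conj μ g₀ w)
      map_smul' := fun c v => by
        simp only [map_smul, RingHom.id_apply]
        exact integral_smul c _ }
    fun h v => by
      change ∫ x, ρ.rep (x * g₀ * x⁻¹) (ρ.rep h v) ∂μ =
        (LinearMap.toContinuousLinearMap (ρ.rep h)) (∫ x, ρ.rep (x * g₀ * x⁻¹) v ∂μ)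
      rw [← ContinuousLinearMap.integral_comp_comm _ (ρ.integrable_rep_conj μ g₀ v),
        ← integral_mul_left_eq_self _ h]
      congr 1 with x : 1
      change ρ.rep (h * x * g₀ * (h * x)⁻¹) (ρ.rep h v) = ρ.rep h (ρ.rep (x * g₀ * x⁻¹) v)
      simp only [← Module.End.mul_apply, ← map_mul]
      rw [show h * x * g₀ * (h * x)⁻¹ * h = h * (x * g₀ * x⁻¹) by group]

theorem UnitaryIrrep.classAverage_apply (ρ : UnitaryIrrep G) (g₀ : G)
    (v : EuclideanSpace ℂ (Fin ρ.dim)) :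
    ρ.classAverage μ g₀ v = ∫ x, ρ.rep (x * g₀ * x⁻¹) v ∂μ := rfl

/-- The trace passes under the integral, where the character is constant on the class and the total
mass is `1`. -/
theorem UnitaryIrrep.trace_classAverage [IsProbabilityMeasure μ] (ρ : UnitaryIrrep G) (g₀ : G) :
    LinearMap.trace ℂ _ (ρ.classAverage μ g₀).toLinearMap = ρ.rep.character g₀ := by
  let b := EuclideanSpace.basisFun (Fin ρ.dim) ℂ
  have hint (i) := ρ.integrable_rep_conj μ g₀ (b i)
  rw [LinearMap.trace_eq_sum_inner _ b]
  simp only [Representation.IntertwiningMap.toLinearMap_apply, classAverage_apply,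
    ← integral_inner (hint _)]
  rw [← integral_finsetSum _ fun i _ => (hint i).const_inner (b i)]
  have h (x : G) : ∑ i, inner ℂ (b i) (ρ.rep (x * g₀ * x⁻¹) (b i)) = ρ.rep.character g₀ := by
    rw [← LinearMap.trace_eq_sum_inner _ b]
    change ρ.rep.character (x * g₀ * x⁻¹) = _
    rw [Representation.char_mul_comm, inv_mul_cancel_left]
  simp_rw [h]
  simp

theorem UnitaryIrrep.classAverage_eq_smul [IsProbabilityMeasure μ] (ρ : UnitaryIrrep G) (g₀ : G)
    (v : EuclideanSpace ℂ (Fin ρ.dim)) :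
    ρ.classAverage μ g₀ v = (ρ.rep.character g₀ / (ρ.dim : ℂ)) • v := by
  have := ρ.irreducible
  obtain ⟨c, hc⟩ := (Representation.IsIrreducible.algebraMap_intertwiningMap_bijective_of_isAlgClosed
    (ρ := ρ.rep)).surjective (ρ.classAverage μ g₀)
  have hcv (v) : ρ.classAverage μ g₀ v = c • v := by
    rw [← hc]
    rfl
  have htr := ρ.trace_classAverage μ g₀
  have hlin : (ρ.classAverage μ g₀).toLinearMap = c • LinearMap.id := LinearMap.ext hcv
  rw [hlin, map_smul, LinearMap.trace_id, finrank_euclideanSpace_fin, smul_eq_mul] at htr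
  rw [hcv, ← htr, mul_div_cancel_right₀ _ (Nat.cast_ne_zero.2 ρ.dim_ne_zero)]

/-- Having finite-dimensional domain, `φ` is continuous and so commutes with the integral. -/
theorem classOperatorAt_intertwiningMap (ρ : UnitaryIrrep G)
    (φ : ρ.rep.IntertwiningMap (leftRegular μ)) (g₀ : G) (v : EuclideanSpace ℂ (Fin ρ.dim)) :
    classOperatorAt μ g₀ (φ v) = φ (ρ.classAverage μ g₀ v) := by
  have h := (LinearMap.toContinuousLinearMap φ.toLinearMap).integral_comp_comm
    (ρ.integrable_rep_conj μ g₀ v)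
  refine Eq.trans ?_ h
  rw [classOperatorAt_apply]
  congr 1 with x : 1
  exact (φ.isIntertwining ρ.rep (leftRegular μ) _ _).symm

/-- The class operator acts as a scalar on each isotypic component. -/
theorem classOperatorAt_of_mem_isotypic [IsProbabilityMeasure μ] (α : Dual G) (g₀ : G)
    {f : Lp ℂ 2 μ} (hf : f ∈ α.isotypic (leftRegular μ)) :
    classOperatorAt μ g₀ f = (α.character g₀ / (α.dim : ℂ)) • f := by
  induction α using Quotient.inductionOn with
  | h ρ =>
    let c : ℂ := ρ.rep.character g₀ / (ρ.dim : ℂ)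
    change classOperatorAt μ g₀ f = c • f
    let K : Submodule ℂ (Lp ℂ 2 μ) :=
      LinearMap.eqLocus (classOperatorAt μ g₀).toLinearMap (c • LinearMap.id)
    have hK : IsClosed (K : Set (Lp ℂ 2 μ)) :=
      isClosed_eq (classOperatorAt μ g₀).continuous (continuous_const_smul c)
    refine isotypic_le ρ hK (fun φ v => ?_) hf
    change classOperatorAt μ g₀ (φ v) = c • φ v
    rw [classOperatorAt_intertwiningMap, ρ.classAverage_eq_smul μ, map_smul]

end ClassAverage

end ClassOp

end

theorem proposition2 {G : Type*} [Group G] [TopologicalSpace G] [IsTopologicalGroup G]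
    [CompactSpace G] [T2Space G] [MeasurableSpace G] [BorelSpace G]
    (μ : MeasureTheory.Measure G) [μ.IsHaarMeasure] [MeasureTheory.IsProbabilityMeasure μ]
    (C₀ : ConjClasses G) :
    (∀ f : MeasureTheory.Lp ℂ 2 μ,
      HasSum
        (fun α : ClassOp.Dual G =>
          ((1 / (α.dim : ℂ)) * α.characterOn C₀) • α.proj (ClassOp.leftRegular μ) f)
        (ClassOp.classOperator μ C₀ f)) ∧
    (∀ (α : ClassOp.Dual G), ∀ g₀ ∈ C₀.carrier,
      ∀ f ∈ α.isotypic (ClassOp.leftRegular μ),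
        ClassOp.classOperator μ C₀ f = (α.character g₀ / (α.dim : ℂ)) • f) := by
  refine ⟨fun f => ?_, fun α g₀ hg₀ f hf => ?_⟩
  · induction C₀ using Quotient.inductionOn with
    | h g₀ =>
      change HasSum _ (ClassOp.classOperatorAt μ g₀ f)
      -- A continuous linear map may be applied to the Hilbert sum term by term.
      convert (ClassOp.classOperatorAt μ g₀).hasSum (ClassOp.hasSum_proj μ
        (ClassOp.norm_leftRegular μ) (ClassOp.continuous_leftRegular μ) f) using 2 with α
      refine Eq.trans ?_ (ClassOp.classOperatorAt_of_mem_isotypic μ α g₀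
        (Submodule.starProjection_apply_mem _ f)).symm
      rw [one_div_mul_eq_div]
      rfl
  · obtain rfl := ConjClasses.mem_carrier_iff_mk_eq.1 hg₀
    exact ClassOp.classOperatorAt_of_mem_isotypic μ α g₀ hf
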